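/- Let $J,H\colon\mathbb{R}^n\to\mathbb{R}\cup\{+\infty\}$ be proper, convex, lower semicontinuous functions, where $\operatorname{dom} f=\{x: f(x)<+\infty\}$, $f^*(p)=\sup_x\{\langle p,x\rangle-f(x)\}$ is the Legendre–Fenchel transform, $\partial f$ is the convex subdifferential, and $I_C$ is the function equal to $0$ on $C$ and $+\infty$ elsewhere. Assume: (A1) $J$ is 1-coercive, i.e. $J(x)/\|x\|\to+\infty$ as $\|x\|\to+\infty$, and $H$ is a Legendre function, i.e. $\operatorname{int}\operatorname{dom}H\neq\emptyset$, $H$ is differentiable and strictly convex on $\operatorname{int}\operatorname{dom}H$, $\partial H(x)=\{\nabla H(x)\}$ for $x\in\operatorname{int}\operatorname{dom}H$, and $\partial H(x)=\emptyset$ for $x\in\operatorname{dom}H\setminus\operatorname{int}\operatorname{dom}H$; and that $0\in\operatorname{dom}J$. Let $D_{H^*}(y,v)=H^*(y)-H^*(v)-\langle\nabla H^*(v),y-v\rangle$ and $$D_F=\Big\{(x,t)\in\mathbb{R}^n\times(0,\infty): \tfrac{x}{t}\in\operatorname{int}\operatorname{dom}H^*\Big\}\cup\big(\operatorname{dom}(I_{\operatorname{dom}H}^*)\times\{0\}\big),$$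 and define $F$ on $D_F$ by $$F(x,t)=\inf_{v\in\operatorname{int}\operatorname{dom}H^*}\Big\{tD_{H^*}\big(\tfrac{x}{t},v\big)+J^*(\nabla H^*(v))\Big\}\quad(t>0),\qquad F(x,0)=I_{\operatorname{dom}H}^*(x)-(J^*+I_{\operatorname{dom}H})^*(x).$$ Then: 1. $F$ is real-valued on $D_F$ and continuously differentiable on $\operatorname{int}D_F$. For every $(x,t)\in\operatorname{int}D_F$, the points $\nabla H^*(\frac{x}{t})$ and $\nabla H^*(\frac{x}{t})-\nabla_xF(x,t)$ lie in $\operatorname{int}\operatorname{dom}H$, and $$\frac{\partial F}{\partial t}(x,t)+H\Big(\nabla H^*\big(\tfrac{x}{t}\big)\Big)-H\Big(\nabla H^*\big(\tfrac{x}{t}\big)-\nabla_xF(x,t)\Big)=0.$$ 2. For all $d\in\operatorname{int}\operatorname{dom}H^*$ and $x\in\operatorname{dom}(I_{\operatorname{dom}H}^*)$, one has $(x+td,t)\in D_F$ for every $t>0$ and $\lim_{t\to0^+}F(x+td,t)=F(x,0)$. 3. For all $t>0$ and $x\in t\operatorname{int}\operatorname{dom}H^*$, the point $\nabla H^*(\frac{x}{t})-\nabla_xF(x,t)$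 lies in $\operatorname{int}\operatorname{dom}H$, and the problem $$\min_{v\in\operatorname{int}\operatorname{dom}H^*}\Big\{tD_{H^*}\big(\tfrac{x}{t},v\big)+J^*(\nabla H^*(v))\Big\}$$ has exactly one minimizer, namely $$\bar v=\nabla H\Big(\nabla H^*\big(\tfrac{x}{t}\big)-\nabla_xF(x,t)\Big).$$ -/

import Mathlib

open scoped Topology Pointwise

namespace NonAdditive

noncomputable section

variable {n : ℕ}

/-- The effective domain `{x : f x < +∞}` of an extended-real-valued function on `ℝⁿ`. -/
def dom (f : EuclideanSpace ℝ (Fin n) → EReal) : Set (EuclideanSpace ℝ (Fin n)) :=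
  {x | f x < ⊤}

/-- The class `Γ₀(ℝⁿ)`: proper, convex, lower semicontinuous functions `ℝⁿ → ℝ ∪ {+∞}`.
Convexity is convexity of the epigraph. -/
structure IsGammaZero (f : EuclideanSpace ℝ (Fin n) → EReal) : Prop where
  ne_bot : ∀ x, f x ≠ ⊥
  proper : ∃ x, f x ≠ ⊤
  convex : Convex ℝ {q : EuclideanSpace ℝ (Fin n) × ℝ | f q.1 ≤ (q.2 : EReal)}
  lsc : LowerSemicontinuous f

/-- 1-coercivity: `f x / ‖x‖ → +∞` as `‖x‖ → +∞`. -/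
def IsOneCoercive (f : EuclideanSpace ℝ (Fin n) → EReal) : Prop :=
  Filter.Tendsto (fun x => f x / ((‖x‖ : ℝ) : EReal))
    (Bornology.cobounded (EuclideanSpace ℝ (Fin n))) (𝓝 ⊤)

/-- The gradient of an extended-real-valued function at a point near which it is finite. -/
def egrad (f : EuclideanSpace ℝ (Fin n) → EReal) (x : EuclideanSpace ℝ (Fin n)) :
    EuclideanSpace ℝ (Fin n) :=
  gradient (fun y => (f y).toReal) x

/-- The convex subdifferential `∂f(x)`. -/
def subdiff (f : EuclideanSpace ℝ (Fin n) → EReal) (x : EuclideanSpace ℝ (Fin n)) :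
    Set (EuclideanSpace ℝ (Fin n)) :=
  {p | ∀ y, f x + ((inner ℝ p (y - x) : ℝ) : EReal) ≤ f y}

/-- The defining properties of a Legendre function (for `f` in `Γ₀(ℝⁿ)`). -/
structure IsLegendre (f : EuclideanSpace ℝ (Fin n) → EReal) : Prop where
  nonempty_interior : (interior (dom f)).Nonempty
  differentiable : ∀ x ∈ interior (dom f), DifferentiableAt ℝ (fun y => (f y).toReal) x
  subdiff_boundary : ∀ x ∈ dom f \ interior (dom f), subdiff f x = ∅
  subdiff_interior : ∀ x ∈ interior (dom f), subdiff f x = {egrad f x}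
  strictConvex : StrictConvexOn ℝ (interior (dom f)) (fun y => (f y).toReal)

/-- The Legendre–Fenchel transform `f*(p) = sup_x {⟨p, x⟩ - f x}`. -/
def conj (f : EuclideanSpace ℝ (Fin n) → EReal) (p : EuclideanSpace ℝ (Fin n)) : EReal :=
  ⨆ x, ((inner ℝ p x : ℝ) : EReal) - f x

open Classical in
/-- The indicator function of `C` in the sense of convex analysis: `0` on `C`, `+∞` elsewhere. -/
def ind (C : Set (EuclideanSpace ℝ (Fin n))) (x : EuclideanSpace ℝ (Fin n)) : EReal :=
  if x ∈ C then 0 else ⊤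

/-- The Bregman distance `D_f(x, u) = f x - f u - ⟨∇f(u), x - u⟩`. -/
def bregman (f : EuclideanSpace ℝ (Fin n) → EReal) (x u : EuclideanSpace ℝ (Fin n)) : EReal :=
  f x - f u - ((inner ℝ (egrad f u) (x - u) : ℝ) : EReal)

/-- The objective `v ↦ t D_{H*}(x/t, v) + J*(∇H*(v))` of the non-additive model. -/
def objective (J H : EuclideanSpace ℝ (Fin n) → EReal) (x : EuclideanSpace ℝ (Fin n)) (t : ℝ)
    (v : EuclideanSpace ℝ (Fin n)) : EReal :=
  (t : EReal) * bregman (conj H) (t⁻¹ • x) v + conj J (egrad (conj H) v)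

/-- The domain `D_F` of the optimal-value function. -/
def domF (H : EuclideanSpace ℝ (Fin n) → EReal) : Set (EuclideanSpace ℝ (Fin n) × ℝ) :=
  {q | 0 < q.2 ∧ q.2⁻¹ • q.1 ∈ interior (dom (conj H))} ∪
    {q | q.1 ∈ dom (conj (ind (dom H))) ∧ q.2 = 0}

/-- The optimal-value function `F` of the non-additive model. Only its values on `domF H`
are meaningful, where it is finite. -/
def optValue (J H : EuclideanSpace ℝ (Fin n) → EReal) (x : EuclideanSpace ℝ (Fin n)) (t : ℝ) :
    EReal :=
  if 0 < t then ⨅ v ∈ interior (dom (conj H)), objective J H x t v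
  else conj (ind (dom H)) x - conj (fun p => conj J p + ind (dom H) p) x

end

end NonAdditive

/-!
The change of variable `p = ∇H^*(v)` and the Fenchel equality `H^*(v) + H(p) = ⟨v, p⟩` turn the
objective into `t H^*(x/t) - (⟨x, p⟩ - J^*(p) - t H(p))`, so that for `t > 0`

  `F(x, t) = (t H)^*(x) - (J^* + t H)^*(x)`.

Both terms are maxima over `p ∈ dom H` of `⟨x, p⟩ - g(p) - t H(p)`, with `g = 0` and `g = J^*`, a
finite convex function bounded below by `-J(0)`. They are treated together for any such `g`
(`maxValue`). On the cone `x/t ∈ int dom H^*` the function `t H - ⟨x, ·⟩` grows linearly, so a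
maximizer exists; by a sum rule for subgradients `∂H` is nonempty there, so it is interior to
`dom H`, where strict convexity makes it unique; and compactness makes it depend continuously on
`(x, t)`. The maximum is a supremum of functions affine in `(x, t)`, with a subgradient
`(p, -H(p))` at the maximizer `p`. A continuous selection of subgradients is a derivative
(`hasFDerivAt_of_continuousOn_subgradient`), so each term is `C¹` with partial derivatives `p` and
`-H(p)`. Since the maximizer for `g = 0` is `∇H^*(x/t)`, the maximizer for `g = J^*` is
`∇H^*(x/t) - ∇ₓF`, and the differential equation is the formula for `∂ₜF`.

The minimizer `v` corresponds to the maximizer `p` under the inverse bijections `∇H` and `∇H^*`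
between `int dom H` and `int dom H^*` (`egrad_mem_and_egrad_conj_egrad`, `egrad_egrad_conj`). For
the initial value, the expression maximized along `(x + t d, t)` is
`⟨x, p⟩ - g(p) + t (⟨d, p⟩ - H(p))`, whose last term is at most `t H^*(d)`
(`IsLegendreOn.tendsto_maxValue_ray`).
-/

namespace NonAdditive

open Filter Set

section RealTheory

variable {E : Type*} [NormedAddCommGroup E] [InnerProductSpace ℝ E]

/-! ### Differentiability from a continuous selection of subgradients -/

/-- A function on an open set that has a subgradient `L z` at every point `z`, depending
continuously on `z`, is differentiable with derivative `L z`. -/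
theorem hasFDerivAt_of_continuousOn_subgradient {X : Type*} [NormedAddCommGroup X]
    [NormedSpace ℝ X] {Ω : Set X} (hΩ : IsOpen Ω) {V : X → ℝ} {L : X → X →L[ℝ] ℝ}
    (hL : ContinuousOn L Ω) (hV : ∀ z ∈ Ω, ∀ w ∈ Ω, V z + L z (w - z) ≤ V w) {z : X}
    (hz : z ∈ Ω) : HasFDerivAt V (L z) z := by
  rw [hasFDerivAt_iff_isLittleO, Asymptotics.isLittleO_iff]
  intro c hc
  have h1 : ∀ᶠ w in 𝓝 z, dist (L w) (L z) < c :=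
    (hL.continuousAt (hΩ.mem_nhds hz)).eventually (Metric.ball_mem_nhds _ hc)
  filter_upwards [h1, hΩ.mem_nhds hz] with w hw hwΩ
  have a := hV z hz w hwΩ
  have b := hV w hwΩ z hz
  have e : L w (z - w) = -(L w (w - z)) := by rw [← neg_sub w z, map_neg]
  have d : (L w - L z) (w - z) ≤ c * ‖w - z‖ := by
    refine (le_abs_self _).trans (((L w - L z).le_opNorm _).trans ?_)
    rw [dist_eq_norm] at hw
    gcongr
  rw [sub_apply] at d
  rw [Real.norm_eq_abs, abs_of_nonneg (by linarith)]
  linarith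

theorem contDiffOn_of_continuousOn_subgradient {X : Type*} [NormedAddCommGroup X]
    [NormedSpace ℝ X] {Ω : Set X} (hΩ : IsOpen Ω) {V : X → ℝ} {L : X → X →L[ℝ] ℝ}
    (hL : ContinuousOn L Ω) (hV : ∀ z ∈ Ω, ∀ w ∈ Ω, V z + L z (w - z) ≤ V w) :
    ContDiffOn ℝ 1 V Ω := by
  have hd := fun z hz => hasFDerivAt_of_continuousOn_subgradient hΩ hL hV (z := z) hz
  have h1 : (1 : WithTop ℕ∞) = 0 + 1 := by simp
  rw [h1, contDiffOn_succ_iff_fderiv_of_isOpen hΩ]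
  refine ⟨fun z hz => (hd z hz).differentiableAt.differentiableWithinAt, by simp, ?_⟩
  rw [contDiffOn_zero]
  exact hL.congr fun z hz => (hd z hz).fderiv

/-! ### Legendre functions and the perturbed conjugates -/

/-- A convex function `h`, finite exactly on `D`, which is closed, essentially smooth and strictly
convex on the interior of its domain. Essential smoothness enters through its consequence
`mem_interior`: subgradients exist only at interior points of `D`. -/
structure IsLegendreOn (D : Set E) (h : E → ℝ) : Prop where
  nonempty : D.Nonempty
  convexOn : ConvexOn ℝ D h
  isClosed_epigraph : IsClosed {w : E × ℝ | w.1 ∈ D ∧ h w.1 ≤ w.2}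
  mem_interior : ∀ p ∈ D, ∀ u, (∀ q ∈ D, h p + inner ℝ u (q - p) ≤ h q) → p ∈ interior D
  strictConvexOn : StrictConvexOn ℝ (interior D) h

/-- The points at which the conjugate of the function equal to `h` on `D` and to `+∞` elsewhere is
finite. -/
def conjDom (D : Set E) (h : E → ℝ) : Set E :=
  {y | BddAbove ((fun p => inner ℝ y p - h p) '' D)}

/-- The expression `⟨x, p⟩ - g p - t h p`, affine in `z = (x, t)`, whose maximum over `p` is
`(g + t h)^*(x)`. -/
def score (h g : E → ℝ) (z : E × ℝ) (p : E) : ℝ := inner ℝ z.1 p - g p - z.2 * h p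

/-- The open cone of those `(x, t)` with `t > 0` for which `x / t` is interior to the domain of
the conjugate of `h`. -/
def perspectiveCone (D : Set E) (h : E → ℝ) : Set (E × ℝ) :=
  {z | 0 < z.2 ∧ z.2⁻¹ • z.1 ∈ interior (conjDom D h)}

/-- The point of `D` at which `score h g z` is maximal (arbitrary if there is none). -/
noncomputable def argmax (D : Set E) (h g : E → ℝ) (z : E × ℝ) : E :=
  Classical.epsilon fun p => p ∈ D ∧ IsMaxOn (score h g z) D p

/-- The maximum of `score h g z` over `D`, that is, `(g + t h)^*(x)` for `z = (x, t)`. -/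
noncomputable def maxValue (D : Set E) (h g : E → ℝ) (z : E × ℝ) : ℝ :=
  score h g z (argmax D h g z)

/-- The differential of `z ↦ score h g z p`. -/
noncomputable def scoreDeriv (h : E → ℝ) (p : E) : E × ℝ →L[ℝ] ℝ :=
  (innerSL ℝ p).comp (.fst ℝ E ℝ) - h p • .snd ℝ E ℝ

theorem scoreDeriv_apply (h : E → ℝ) (p : E) (w : E × ℝ) :
    scoreDeriv h p w = inner ℝ w.1 p - h p * w.2 := by
  simp [scoreDeriv, real_inner_comm]

theorem score_add (h g : E → ℝ) (z w : E × ℝ) (p : E) :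
    score h g w p = score h g z p + scoreDeriv h p (w - z) := by
  simp only [score, scoreDeriv_apply, Prod.fst_sub, Prod.snd_sub, inner_sub_left]
  ring

theorem convex_conjDom (D : Set E) (h : E → ℝ) : Convex ℝ (conjDom D h) := by
  rintro y ⟨M, hM⟩ y' ⟨M', hM'⟩ a b ha hb hab
  refine ⟨a * M + b * M', ?_⟩
  rintro _ ⟨p, hp, rfl⟩
  have h1 := hM ⟨p, hp, rfl⟩
  have h2 := hM' ⟨p, hp, rfl⟩
  simp only [inner_add_left, real_inner_smul_left] at *
  have : b = 1 - a := by linarith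
  subst this
  nlinarith

theorem isOpen_perspectiveCone (D : Set E) (h : E → ℝ) : IsOpen (perspectiveCone D h) := by
  have hc : ContinuousOn (fun z : E × ℝ => z.2⁻¹ • z.1) {z | 0 < z.2} := fun z hz =>
    ((continuousAt_snd.inv₀ (ne_of_gt hz)).smul continuousAt_fst).continuousWithinAt
  exact hc.isOpen_inter_preimage (isOpen_lt continuous_const continuous_snd) isOpen_interior

theorem convexOn_sSup_conj {D : Set E} {h : E → ℝ} (hD : D.Nonempty) :
    ConvexOn ℝ (conjDom D h) fun y => sSup ((fun p => inner ℝ y p - h p) '' D) := by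
  refine ⟨convex_conjDom D h, fun y hy y' hy' a b ha hb hab => ?_⟩
  refine csSup_le (hD.image _) ?_
  rintro _ ⟨p, hp, rfl⟩
  have h1 := le_csSup hy ⟨p, hp, rfl⟩
  have h2 := le_csSup hy' ⟨p, hp, rfl⟩
  simp only [inner_add_left, real_inner_smul_left, smul_eq_mul] at *
  have : b = 1 - a := by linarith
  subst this
  nlinarith

/-- The domain of the conjugate recedes in the directions in which `D` is bounded. -/
theorem add_mem_interior_conjDom {D : Set E} {h : E → ℝ} {d e : E} (hd : d ∈ interior (conjDom D h))
    (he : BddAbove ((fun p => inner ℝ e p) '' D)) : e + d ∈ interior (conjDom D h) := by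
  obtain ⟨M, hM⟩ := he
  have hsub : e +ᵥ interior (conjDom D h) ⊆ conjDom D h := by
    rintro _ ⟨y, hy, rfl⟩
    obtain ⟨N, hN⟩ := interior_subset hy
    refine ⟨M + N, ?_⟩
    rintro _ ⟨p, hp, rfl⟩
    have h1 := hM ⟨p, hp, rfl⟩
    have h2 := hN ⟨p, hp, rfl⟩
    simp only [vadd_eq_add, inner_add_left] at *
    linarith
  exact interior_maximal hsub (isOpen_interior.vadd e) ⟨d, hd, rfl⟩

theorem ray_mem_perspectiveCone {D : Set E} {h : E → ℝ} {d x : E} {t : ℝ}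
    (hd : d ∈ interior (conjDom D h))
    (hx : BddAbove ((fun p => inner ℝ x p) '' D)) (ht : 0 < t) :
    (x + t • d, t) ∈ perspectiveCone D h := by
  refine ⟨ht, ?_⟩
  have : t⁻¹ • (x + t • d) = t⁻¹ • x + d := by rw [smul_add, inv_smul_smul₀ ht.ne']
  rw [this]
  obtain ⟨M, hM⟩ := hx
  refine add_mem_interior_conjDom hd ⟨t⁻¹ * M, ?_⟩
  rintro _ ⟨p, hp, rfl⟩
  have h1 := hM ⟨p, hp, rfl⟩
  simp only [real_inner_smul_left]
  gcongr

variable [FiniteDimensional ℝ E]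

/-! ### A sum rule for subgradients -/

/-- If `f + g` is minimal over `D` at `p`, where `f` is convex on `D` and `g` is convex and finite
everywhere, then `f` has a subgradient at `p`. This is the part of the sum rule
`∂(f + g) = ∂f + ∂g` that the optimality conditions require. -/
theorem exists_subgradient_of_isMinOn_add {D : Set E} {f g : E → ℝ} (hf : ConvexOn ℝ D f)
    (hg : ConvexOn ℝ univ g) {p : E} (hp : p ∈ D) (hmin : ∀ q ∈ D, f p + g p ≤ f q + g q) :
    ∃ u : E, ∀ q ∈ D, f p + inner ℝ u (q - p) ≤ f q := by
  have hgc : Continuous g := hg.locallyLipschitz.continuous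
  have hs : Convex ℝ {w : E × ℝ | w.2 < g p - g w.1} := by
    have := ((concaveOn_const (𝕜 := ℝ) (g p) convex_univ).sub hg).convex_strict_hypograph
    simpa using this
  have hso : IsOpen {w : E × ℝ | w.2 < g p - g w.1} :=
    isOpen_lt continuous_snd (continuous_const.sub (hgc.comp continuous_fst))
  have ht : Convex ℝ {w : E × ℝ | w.1 ∈ D ∧ f w.1 - f p ≤ w.2} := by
    simpa using (hf.sub (concaveOn_const (𝕜 := ℝ) (f p) hf.1)).convex_epigraph
  -- separate the open strict hypograph of `g p - g` from the epigraph of `f - f p`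
  obtain ⟨F, c, hFs, hFt⟩ := geometric_hahn_banach_open hs hso ht <| by
    rw [Set.disjoint_left]
    rintro ⟨q, r⟩ h1 ⟨h2, h3⟩
    have := hmin q h2
    simp only [mem_ofPred_eq] at h1 h3
    linarith
  have hsplit : ∀ q r, F (q, r) = F (q, 0) + r * F (0, 1) := by
    intro q r
    have : ((q, r) : E × ℝ) = (q, 0) + r • (0, 1) := by simp
    rw [this, map_add, map_smul, smul_eq_mul]
  set b := F (0, 1) with hb
  have h1 : c ≤ F (p, 0) := hFt (p, 0) ⟨hp, by simp⟩
  have h2 : ∀ r < 0, F (p, 0) + r * b < c := fun r hr => by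
    rw [← hsplit]; exact hFs (p, r) (by simpa using hr)
  -- the separating hyperplane is not vertical because `g` is finite at `p`
  have hb0 : 0 < b := by linarith [h2 (-1) (by norm_num)]
  have h3 : F (p, 0) ≤ c := by
    by_contra! h
    have := h2 ((c - F (p, 0)) / b) (div_neg_of_neg_of_pos (by linarith) hb0)
    rw [div_mul_cancel₀ _ hb0.ne'] at this
    linarith
  refine ⟨-b⁻¹ • (InnerProductSpace.toDual ℝ E).symm (F.comp (.inl ℝ E ℝ)), fun q hq => ?_⟩
  have h4 := hFt (q, f q - f p) ⟨hq, le_rfl⟩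
  rw [hsplit] at h4
  rw [inner_smul_left, InnerProductSpace.toDual_symm_apply]
  have h5 : (F.comp (.inl ℝ E ℝ)) (q - p) = F (q, 0) - F (p, 0) := by
    simp [← map_sub]
  rw [h5]
  have h6 : F (p, 0) - F (q, 0) ≤ (f q - f p) * b := by linarith
  have h7 : b⁻¹ * (F (p, 0) - F (q, 0)) ≤ f q - f p := by
    rw [inv_mul_le_iff₀ hb0]; linarith
  simp only [conj_trivial]
  linarith

/-! ### Existence, uniqueness and continuity of the maximizer -/

/-- Interior points of the domain of the conjugate are slopes that `h` exceeds at a linear rate. -/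
theorem exists_linear_growth {D : Set E} {h : E → ℝ} (hD : D.Nonempty) {y : E}
    (hy : y ∈ interior (conjDom D h)) :
    ∃ ε > 0, ∃ C, ∀ p ∈ D, inner ℝ y p + ε * ‖p‖ - C ≤ h p := by
  have hcont := (convexOn_sSup_conj (h := h) hD).continuousOn_interior.continuousAt
    (isOpen_interior.mem_nhds hy)
  set S := fun y => sSup ((fun p => inner ℝ y p - h p) '' D) with hS
  have hev : ∀ᶠ w in 𝓝 y, S w < S y + 1 ∧ w ∈ interior (conjDom D h) :=
    (hcont.eventually (Iio_mem_nhds (by linarith))).and (isOpen_interior.mem_nhds hy)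
  obtain ⟨ε, hε, hball⟩ := Metric.nhds_basis_closedBall.eventually_iff.1 hev
  refine ⟨ε, hε, S y + 1, fun p hp => ?_⟩
  -- test the Fenchel inequality at `y` shifted by `ε` in the direction of `p`
  obtain ⟨e, he, hep⟩ : ∃ e : E, ‖e‖ ≤ 1 ∧ inner ℝ e p = ‖p‖ := by
    rcases eq_or_ne p 0 with rfl | hp0
    · exact ⟨0, by simp, by simp⟩
    · have := norm_pos_iff.2 hp0
      refine ⟨‖p‖⁻¹ • p, by rw [norm_smul, norm_inv, norm_norm, inv_mul_cancel₀ this.ne'], ?_⟩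
      rw [real_inner_smul_left, real_inner_self_eq_norm_sq]
      field_simp
  have hmem : y + ε • e ∈ Metric.closedBall y ε := by
    rw [mem_closedBall_iff_norm, add_sub_cancel_left, norm_smul, Real.norm_of_nonneg hε.le]
    nlinarith
  obtain ⟨h1, h2⟩ := hball hmem
  have h3 : inner ℝ (y + ε • e) p - h p ≤ S (y + ε • e) := le_csSup 
    (interior_subset h2 : _ ∈ conjDom D h) ⟨p, hp, rfl⟩
  rw [inner_add_left, real_inner_smul_left, hep] at h3
  linarith

variable {D : Set E} {h g : E → ℝ} {z : E × ℝ}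

theorem IsLegendreOn.mem_interior_of_isMaxOn (hL : IsLegendreOn D h) (hg : ConvexOn ℝ univ g)
    (ht : 0 < z.2) {p : E} (hp : p ∈ D) (hmax : IsMaxOn (score h g z) D p) :
    p ∈ interior D := by
  have hf : ConvexOn ℝ D fun q => z.2 * h q - inner ℝ z.1 q := by
    refine (hL.convexOn.smul ht.le).sub ⟨hL.convexOn.1, fun q _ r _ a b _ _ _ => ?_⟩
    simp [inner_add_right, real_inner_smul_right]
  obtain ⟨u, hu⟩ := exists_subgradient_of_isMinOn_add hf hg hp fun q hq => by
    have := isMaxOn_iff.1 hmax q hq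
    simp only [score] at this
    linarith
  refine hL.mem_interior p hp (z.2⁻¹ • (u + z.1)) fun q hq => ?_
  have h1 := hu q hq
  rw [real_inner_smul_left, inner_add_left]
  simp only [inner_sub_right] at *
  have h2 : z.2⁻¹ * (inner ℝ u q - inner ℝ u p + (inner ℝ z.1 q - inner ℝ z.1 p)) ≤ h q - h p := by
    rw [inv_mul_le_iff₀ ht]; linarith
  linarith

theorem IsLegendreOn.eq_of_isMaxOn (hL : IsLegendreOn D h) (hg : ConvexOn ℝ univ g)
    (ht : 0 < z.2) {p q : E} (hp : p ∈ D) (hmax : IsMaxOn (score h g z) D p)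
    (hq : q ∈ D) (hmax' : IsMaxOn (score h g z) D q) : p = q := by
  by_contra hne
  have half : (0 : ℝ) < 1 / 2 := by norm_num
  have h1 := hL.strictConvexOn.2 (hL.mem_interior_of_isMaxOn hg ht hp hmax)
    (hL.mem_interior_of_isMaxOn hg ht hq hmax') hne half half (add_halves 1)
  have h2 := hg.2 (mem_univ p) (mem_univ q) half.le half.le (add_halves 1)
  have h3 := hL.convexOn.1 hp hq half.le half.le (add_halves 1)
  have h4 := isMaxOn_iff.1 hmax _ h3
  have h5 := isMaxOn_iff.1 hmax' _ h3
  simp only [score, inner_add_right, real_inner_smul_right, smul_eq_mul] at *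
  have h6 := mul_lt_mul_of_pos_left h1 ht
  linarith

/-- If `z k → z` in the cone and the points `p k` are asymptotically at least as good for `z k` as
any competitor is for `z`, then some subsequence of `p k` converges to a maximizer for `z`. Applied
to a constant sequence `z k` this gives existence of maximizers, and applied to maximizers `p k` it
gives their continuous dependence on `z`. -/
theorem IsLegendreOn.exists_subseq_tendsto_isMaxOn (hL : IsLegendreOn D h)
    (hg : ConvexOn ℝ univ g) {c : ℝ} (hgc : ∀ p, c ≤ g p) (hz : z ∈ perspectiveCone D h)
    {zs : ℕ → E × ℝ} (hzs : Tendsto zs atTop (𝓝 z)) {ps : ℕ → E} (hps : ∀ᶠ k in atTop, ps k ∈ D)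
    (hopt : ∀ q ∈ D, ∀ δ > 0, ∀ᶠ k in atTop, score h g z q - δ ≤ score h g (zs k) (ps k)) :
    ∃ p ∈ D, IsMaxOn (score h g z) D p ∧ ∃ φ : ℕ → ℕ, StrictMono φ ∧
      Tendsto (ps ∘ φ) atTop (𝓝 p) := by
  obtain ⟨ht, hy⟩ := hz
  have hgcont : Continuous g := hg.locallyLipschitz.continuous
  obtain ⟨ε, hε, C, hC⟩ := exists_linear_growth hL.nonempty hy
  obtain ⟨q₀, hq₀⟩ := hL.nonempty
  set t := z.2 with ht_def
  have hz1 : Tendsto (fun k => (zs k).1) atTop (𝓝 z.1) := (continuous_fst.tendsto z).comp hzs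
  have hz2 : Tendsto (fun k => (zs k).2) atTop (𝓝 t) := (continuous_snd.tendsto z).comp hzs
  have hdrift : Tendsto (fun k => ‖(zs k).1 - (zs k).2 • t⁻¹ • z.1‖) atTop (𝓝 0) := by
    have : Tendsto (fun k => ‖(zs k).1 - (zs k).2 • t⁻¹ • z.1‖) atTop
        (𝓝 ‖z.1 - t • t⁻¹ • z.1‖) := (hz1.sub (hz2.smul_const _)).norm
    rwa [smul_inv_smul₀ ht.ne', sub_self, norm_zero] at this
  -- the linear growth of `h` dominates the perturbation of the slope and bounds the sequence
  have hbdd : ∀ᶠ k in atTop, ps k ∈ Metric.closedBall (0 : E)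
      ((2 * t * |C| - c - (score h g z q₀ - 1)) / (t * ε / 4)) := by
    filter_upwards [hps, hopt q₀ hq₀ 1 one_pos,
      hdrift.eventually (Iio_mem_nhds (show 0 < t * ε / 4 by positivity)),
      hz2.eventually (Ioo_mem_nhds (show t / 2 < t by linarith) (show t < 2 * t by linarith))]
      with k hk hs hd htk
    obtain ⟨htk1, htk2⟩ := htk
    rw [mem_closedBall_zero_iff, le_div_iff₀ (by positivity)]
    have h1 := mul_le_mul_of_nonneg_left (hC (ps k) hk) (show 0 ≤ (zs k).2 by linarith)
    have h2 : inner ℝ ((zs k).1 - (zs k).2 • t⁻¹ • z.1) (ps k) ≤ t * ε / 4 * ‖ps k‖ :=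
      (real_inner_le_norm _ _).trans (by gcongr)
    have h3 := hgc (ps k)
    have h4 : t / 2 * (ε * ‖ps k‖) ≤ (zs k).2 * (ε * ‖ps k‖) := by gcongr
    have h5 : (zs k).2 * C ≤ 2 * t * |C| := by
      refine (mul_le_mul_of_nonneg_left (le_abs_self C) (by linarith)).trans ?_
      gcongr
    rw [inner_sub_left, real_inner_smul_left] at h2
    simp only [score] at hs ⊢
    linarith
  obtain ⟨p, -, φ, hφ, hlim⟩ :=
    tendsto_subseq_of_frequently_bounded Metric.isBounded_closedBall hbdd.frequently
  have hφt := hφ.tendsto_atTop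
  -- the limit stays in the closed epigraph of `h`, which transfers the optimality bound to it
  have key : ∀ q ∈ D, ∀ δ > 0, p ∈ D ∧
      h p ≤ t⁻¹ * (inner ℝ z.1 p - g p - (score h g z q - δ)) := by
    intro q hq δ hδ
    have hlim2 : Tendsto (fun k => ((ps ∘ φ) k, ((zs (φ k)).2)⁻¹ *
        (inner ℝ (zs (φ k)).1 ((ps ∘ φ) k) - g ((ps ∘ φ) k) - (score h g z q - δ)))) atTop
        (𝓝 (p, t⁻¹ * (inner ℝ z.1 p - g p - (score h g z q - δ)))) := by
      refine hlim.prodMk_nhds (((hz2.comp hφt).inv₀ ht.ne').mul ?_)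
      exact ((((hz1.comp hφt).inner hlim).sub ((hgcont.tendsto p).comp hlim)).sub_const _)
    refine hL.isClosed_epigraph.mem_of_tendsto hlim2 ?_
    filter_upwards [hφt.eventually hps, hφt.eventually (hopt q hq δ hδ),
      (hz2.comp hφt).eventually (Ioi_mem_nhds ht)] with k h1 h2 h3
    refine ⟨h1, ?_⟩
    have h3' : 0 < (zs (φ k)).2 := h3
    rw [le_inv_mul_iff₀ h3']
    simp only [score, Function.comp] at *
    linarith
  refine ⟨p, (key q₀ hq₀ 1 one_pos).1, isMaxOn_iff.2 fun q hq => ?_, φ, hφ, hlim⟩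
  refine le_of_forall_pos_le_add fun δ hδ => ?_
  have h1 := (key q hq δ hδ).2
  rw [le_inv_mul_iff₀ ht] at h1
  change score h g z q ≤ inner ℝ z.1 p - g p - t * h p + δ
  linarith

theorem IsLegendreOn.argmax_spec (hL : IsLegendreOn D h)
    (hg : ConvexOn ℝ univ g) {c : ℝ} (hgc : ∀ p, c ≤ g p) (hz : z ∈ perspectiveCone D h) :
    argmax D h g z ∈ D ∧ IsMaxOn (score h g z) D (argmax D h g z) := by
  refine Classical.epsilon_spec (p := fun p => p ∈ D ∧ IsMaxOn (score h g z) D p) ?_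
  have hbdd : BddAbove (score h g z '' D) := by
    obtain ⟨M, hM⟩ : z.2⁻¹ • z.1 ∈ conjDom D h := interior_subset hz.2
    refine ⟨z.2 * M - c, ?_⟩
    rintro _ ⟨p, hp, rfl⟩
    have h1 := mul_le_mul_of_nonneg_left (hM ⟨p, hp, rfl⟩) hz.1.le
    have h2 := hgc p
    simp only [real_inner_smul_left, mul_sub, mul_inv_cancel_left₀ hz.1.ne'] at h1
    simp only [score]
    linarith
  have hex : ∀ k : ℕ, ∃ p ∈ D, sSup (score h g z '' D) - 1 / ((k : ℝ) + 1) < score h g z p := by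
    intro k
    obtain ⟨_, ⟨p, hp, rfl⟩, hlt⟩ := exists_lt_of_lt_csSup (hL.nonempty.image (score h g z))
      (show sSup (score h g z '' D) - 1 / ((k : ℝ) + 1) < _ from
        sub_lt_self _ Nat.one_div_pos_of_nat)
    exact ⟨p, hp, hlt⟩
  choose ps hps hps' using hex
  obtain ⟨p, hp, hmax, -⟩ := hL.exists_subseq_tendsto_isMaxOn hg hgc hz tendsto_const_nhds
    (.of_forall hps) fun q hq δ hδ => by
      filter_upwards [tendsto_one_div_add_atTop_nhds_zero_nat.eventually (Iio_mem_nhds hδ)]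
        with k hk
      have h1 := le_csSup hbdd ⟨q, hq, rfl⟩
      have h2 := hps' k
      have h3 : 1 / ((k : ℝ) + 1) < δ := hk
      linarith
  exact ⟨p, hp, hmax⟩

theorem IsLegendreOn.argmax_eq (hL : IsLegendreOn D h)
    (hg : ConvexOn ℝ univ g) (ht : 0 < z.2) {p : E} (hp : p ∈ D)
    (hmax : IsMaxOn (score h g z) D p) : argmax D h g z = p := by
  obtain ⟨h1, h2⟩ := Classical.epsilon_spec
    (p := fun p => p ∈ D ∧ IsMaxOn (score h g z) D p) ⟨p, hp, hmax⟩
  exact hL.eq_of_isMaxOn hg ht h1 h2 hp hmax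

theorem IsLegendreOn.argmax_mem_interior (hL : IsLegendreOn D h)
    (hg : ConvexOn ℝ univ g) {c : ℝ} (hgc : ∀ p, c ≤ g p) (hz : z ∈ perspectiveCone D h) :
    argmax D h g z ∈ interior D :=
  hL.mem_interior_of_isMaxOn hg hz.1 (hL.argmax_spec hg hgc hz).1 (hL.argmax_spec hg hgc hz).2

theorem IsLegendreOn.continuousOn_argmax (hL : IsLegendreOn D h)
    (hg : ConvexOn ℝ univ g) {c : ℝ} (hgc : ∀ p, c ≤ g p) :
    ContinuousOn (argmax D h g) (perspectiveCone D h) := by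
  intro z hz
  refine tendsto_of_subseq_tendsto fun zs hzs => ?_
  have hzs' := tendsto_nhdsWithin_iff.1 hzs
  obtain ⟨p, hp, hmax, φ, -, hφ⟩ := hL.exists_subseq_tendsto_isMaxOn hg hgc hz hzs'.1
    (ps := fun k => argmax D h g (zs k))
    (hzs'.2.mono fun k hk => (hL.argmax_spec hg hgc hk).1) fun q hq δ hδ => by
      have hsc : Continuous fun w : E × ℝ => score h g w q := by
        unfold score; fun_prop
      filter_upwards [hzs'.2, ((hsc.tendsto z).comp hzs'.1).eventually
        (Ioi_mem_nhds (show score h g z q - δ < score h g z q by linarith))] with k hk h1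
      exact (le_of_lt h1).trans (isMaxOn_iff.1 (hL.argmax_spec hg hgc hk).2 q hq)
  exact ⟨φ, by rwa [hL.argmax_eq hg hz.1 hp hmax]⟩

/-! ### Smoothness of the perturbed conjugates and Legendre duality -/

theorem IsLegendreOn.continuousOn_scoreDeriv (hL : IsLegendreOn D h)
    (hg : ConvexOn ℝ univ g) {c : ℝ} (hgc : ∀ p, c ≤ g p) :
    ContinuousOn (fun z => scoreDeriv h (argmax D h g z)) (perspectiveCone D h) := by
  have h1 := hL.continuousOn_argmax hg hgc
  have h2 : ContinuousOn (fun z => h (argmax D h g z)) (perspectiveCone D h) :=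
    hL.convexOn.continuousOn_interior.comp h1 fun z hz => hL.argmax_mem_interior hg hgc hz
  unfold scoreDeriv
  refine ContinuousOn.sub ?_ (h2.smul continuousOn_const)
  exact ContinuousOn.clm_comp ((innerSL ℝ).continuous.comp_continuousOn h1) continuousOn_const

theorem IsLegendreOn.maxValue_subgradient (hL : IsLegendreOn D h)
    (hg : ConvexOn ℝ univ g) {c : ℝ} (hgc : ∀ p, c ≤ g p) :
    ∀ z ∈ perspectiveCone D h, ∀ w ∈ perspectiveCone D h,
      maxValue D h g z + scoreDeriv h (argmax D h g z) (w - z) ≤ maxValue D h g w :=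
  fun z hz w hw => (score_add h g z w _).symm.le.trans
    (isMaxOn_iff.1 (hL.argmax_spec hg hgc hw).2 _ (hL.argmax_spec hg hgc hz).1)

theorem IsLegendreOn.hasFDerivAt_maxValue (hL : IsLegendreOn D h)
    (hg : ConvexOn ℝ univ g) {c : ℝ} (hgc : ∀ p, c ≤ g p) (hz : z ∈ perspectiveCone D h) :
    HasFDerivAt (maxValue D h g) (scoreDeriv h (argmax D h g z)) z :=
  hasFDerivAt_of_continuousOn_subgradient (isOpen_perspectiveCone D h)
    (hL.continuousOn_scoreDeriv hg hgc) (hL.maxValue_subgradient hg hgc) hz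

theorem IsLegendreOn.contDiffOn_maxValue (hL : IsLegendreOn D h)
    (hg : ConvexOn ℝ univ g) {c : ℝ} (hgc : ∀ p, c ≤ g p) :
    ContDiffOn ℝ 1 (maxValue D h g) (perspectiveCone D h) :=
  contDiffOn_of_continuousOn_subgradient (isOpen_perspectiveCone D h)
    (hL.continuousOn_scoreDeriv hg hgc) (hL.maxValue_subgradient hg hgc)

/-- Subgradients of a Legendre function are interior to the domain of its conjugate: a unique
maximizer `p` of `⟨y, ·⟩ - h` forces linear decay away from `p`, which leaves room to move `y`. -/
theorem IsLegendreOn.mem_interior_conjDom (hL : IsLegendreOn D h) {y p : E} (hp : p ∈ D)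
    (hsub : ∀ q ∈ D, h p + inner ℝ y (q - p) ≤ h q) : y ∈ interior (conjDom D h) := by
  have huniq : ∀ q ∈ D, h q ≤ h p + inner ℝ y (q - p) → q = p := by
    intro q hq hle
    refine hL.eq_of_isMaxOn (g := 0) (z := (y, 1)) (convexOn_const 0 convex_univ) one_pos
      hq ?_ hp ?_
    · refine isMaxOn_iff.2 fun r hr => ?_
      have := hsub r hr
      simp only [score, Pi.zero_apply, inner_sub_right] at *
      linarith
    · refine isMaxOn_iff.2 fun r hr => ?_
      have := hsub r hr
      simp only [score, Pi.zero_apply, inner_sub_right] at *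
      linarith
  -- the gap has a positive minimum on the unit sphere around `p`; convexity propagates it outward
  obtain ⟨ε, hε, hsphere⟩ : ∃ ε > 0, ∀ q ∈ D, ‖q - p‖ = 1 →
      ε ≤ h q - h p - inner ℝ y (q - p) := by
    by_contra! hcon
    choose qs hqD hqn hqs using fun k : ℕ => hcon (1 / ((k : ℝ) + 1)) Nat.one_div_pos_of_nat
    obtain ⟨q, hq, φ, hφ, hlim⟩ := (isCompact_sphere p 1).tendsto_subseq
      (x := qs) fun k => by simpa [dist_eq_norm] using hqn k
    have hlim2 : Tendsto (fun k => ((qs ∘ φ) k, h p + inner ℝ y ((qs ∘ φ) k - p)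
        + 1 / (((φ k : ℕ) : ℝ) + 1))) atTop (𝓝 (q, h p + inner ℝ y (q - p) + 0)) := by
      refine hlim.prodMk_nhds (Tendsto.add ?_
        (tendsto_one_div_add_atTop_nhds_zero_nat.comp hφ.tendsto_atTop))
      exact (tendsto_const_nhds.inner (hlim.sub_const p)).const_add _
    obtain ⟨h1, h2⟩ := hL.isClosed_epigraph.mem_of_tendsto hlim2 <| .of_forall fun k =>
      ⟨hqD _, by have := hqs (φ k); simp only [Function.comp]; linarith⟩
    have h3 := huniq q h1 (by simpa using h2)
    rw [h3] at hq
    simp at hq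
  have hgrow : ∀ q ∈ D, ε * ‖q - p‖ - ε ≤ h q - h p - inner ℝ y (q - p) := by
    intro q hq
    rcases le_total ‖q - p‖ 1 with hle | hle
    · have := hsub q hq
      nlinarith
    · have hpos : 0 < ‖q - p‖ := by linarith
      set s := ‖q - p‖⁻¹ with hs
      have hs1 : s ≤ 1 := inv_le_one_of_one_le₀ hle
      have hs0 : 0 < s := inv_pos.2 hpos
      have hmem : (1 - s) • p + s • q ∈ D :=
        hL.convexOn.1 hp hq (by linarith) hs0.le (by ring)
      have hdiff : (1 - s) • p + s • q - p = s • (q - p) := by module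
      have h1 := hsphere _ hmem (by
        rw [hdiff, norm_smul, Real.norm_of_nonneg hs0.le, inv_mul_cancel₀ hpos.ne'])
      have h2 := hL.convexOn.2 hp hq (show 0 ≤ 1 - s by linarith) hs0.le (by ring)
      rw [hdiff, real_inner_smul_right] at h1
      simp only [smul_eq_mul] at h2
      have h3 : ε ≤ s * (h q - h p - inner ℝ y (q - p)) := by linarith
      rw [le_inv_mul_iff₀ hpos] at h3
      linarith
  refine mem_interior_iff_mem_nhds.2 (Metric.mem_nhds_iff.2 ⟨ε, hε, fun y' hy' => ?_⟩)
  refine ⟨ε - h p + inner ℝ y' p, ?_⟩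
  rintro _ ⟨q, hq, rfl⟩
  have h1 := hgrow q hq
  rw [mem_ball_iff_norm] at hy'
  have h2 : inner ℝ (y' - y) (q - p) ≤ ε * ‖q - p‖ :=
    (real_inner_le_norm _ _).trans (by gcongr)
  simp only [inner_sub_left, inner_sub_right] at *
  linarith

/-! ### Behaviour as the time tends to zero -/

/-- Along a ray `(x + t d, t)` the score is `⟨x, p⟩ - g p + t (⟨d, p⟩ - h p)`. The last term is
bounded above uniformly in `p` and vanishes in the limit for each `p`, so that the maxima converge
to the supremum of the first two terms. -/
theorem IsLegendreOn.tendsto_maxValue_ray (hL : IsLegendreOn D h)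
    (hg : ConvexOn ℝ univ g) {c : ℝ} (hgc : ∀ p, c ≤ g p) {d x : E}
    (hd : d ∈ interior (conjDom D h)) (hx : BddAbove ((fun p => inner ℝ x p) '' D)) {l : ℝ}
    (hl : IsLUB ((fun p => inner ℝ x p - g p) '' D) l) :
    Tendsto (fun t : ℝ => maxValue D h g (x + t • d, t)) (𝓝[>] 0) (𝓝 l) := by
  have hscore : ∀ t p, score h g (x + t • d, t) p
      = inner ℝ x p - g p + t * (inner ℝ d p - h p) := by
    intro t p
    simp only [score, inner_add_left, real_inner_smul_left]
    ring
  have hlim : ∀ a b : ℝ, Tendsto (fun t : ℝ => a + t * b) (𝓝[>] 0) (𝓝 a) := by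
    intro a b
    have : Tendsto (fun t : ℝ => a + t * b) (𝓝 0) (𝓝 (a + 0 * b)) :=
      (continuous_const.add (continuous_id.mul continuous_const)).tendsto 0
    rw [zero_mul, add_zero] at this
    exact this.mono_left nhdsWithin_le_nhds
  obtain ⟨M, hM⟩ := interior_subset hd
  refine tendsto_order.2 ⟨fun a ha => ?_, fun a ha => ?_⟩
  · obtain ⟨_, ⟨p, hp, rfl⟩, hpa, -⟩ := hl.exists_between ha
    filter_upwards [self_mem_nhdsWithin, (hlim _ (inner ℝ d p - h p)).eventually
      (Ioi_mem_nhds hpa)] with t ht hta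
    refine lt_of_lt_of_le hta ?_
    have h1 := isMaxOn_iff.1
      (hL.argmax_spec hg hgc (ray_mem_perspectiveCone (t := t) hd hx ht)).2 p hp
    rw [hscore] at h1
    exact h1
  · filter_upwards [self_mem_nhdsWithin, (hlim l M).eventually (Iio_mem_nhds ha)] with t ht hta
    refine lt_of_le_of_lt ?_ hta
    have hp := (hL.argmax_spec hg hgc (ray_mem_perspectiveCone (t := t) hd hx ht)).1
    rw [maxValue, hscore]
    have h1 := hl.1 ⟨_, hp, rfl⟩
    have h2 := mul_le_mul_of_nonneg_left (hM ⟨_, hp, rfl⟩) (le_of_lt ht)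
    simp only at h1 h2
    linarith

end RealTheory

section Extended

variable {n : ℕ} {f J H : EuclideanSpace ℝ (Fin n) → EReal}

/-! ### Extended-real-valued functions and their conjugates -/

theorem coe_toReal_of_mem_dom (hbot : ∀ x, f x ≠ ⊥) {x : EuclideanSpace ℝ (Fin n)}
    (hx : x ∈ dom f) : ((f x).toReal : EReal) = f x :=
  EReal.coe_toReal (ne_of_lt hx) (hbot x)

theorem coe_le_conj (hbot : ∀ x, f x ≠ ⊥) {x : EuclideanSpace ℝ (Fin n)} (hx : x ∈ dom f)
    (p : EuclideanSpace ℝ (Fin n)) :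
    ((inner ℝ p x - (f x).toReal : ℝ) : EReal) ≤ conj f p := by
  rw [EReal.coe_sub, coe_toReal_of_mem_dom hbot hx]
  exact le_iSup (fun x => ((inner ℝ p x : ℝ) : EReal) - f x) x

theorem conj_ne_bot (hbot : ∀ x, f x ≠ ⊥) (hne : (dom f).Nonempty)
    (p : EuclideanSpace ℝ (Fin n)) : conj f p ≠ ⊥ := by
  obtain ⟨x, hx⟩ := hne
  exact ne_bot_of_le_ne_bot (EReal.coe_ne_bot _) (coe_le_conj hbot hx p)

theorem conj_le_coe (hbot : ∀ x, f x ≠ ⊥) {p : EuclideanSpace ℝ (Fin n)} {M : ℝ}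
    (hM : M ∈ upperBounds ((fun x => inner ℝ p x - (f x).toReal) '' dom f)) :
    conj f p ≤ M := by
  refine iSup_le fun x => ?_
  by_cases hx : x ∈ dom f
  · rw [← coe_toReal_of_mem_dom hbot hx, ← EReal.coe_sub]
    exact EReal.coe_le_coe_iff.2 (hM ⟨x, hx, rfl⟩)
  · have : f x = ⊤ := not_lt_top_iff.1 hx
    simp [this]

theorem conj_eq_coe (hbot : ∀ x, f x ≠ ⊥) {p : EuclideanSpace ℝ (Fin n)} {M : ℝ}
    (hM : IsLUB ((fun x => inner ℝ p x - (f x).toReal) '' dom f) M) : conj f p = M := by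
  refine le_antisymm (conj_le_coe hbot hM.1) ?_
  have hne : (dom f).Nonempty := hM.nonempty.of_image
  have htop : conj f p ≠ ⊤ := ne_top_of_le_ne_top (EReal.coe_ne_top _) (conj_le_coe hbot hM.1)
  rw [← EReal.coe_toReal htop (conj_ne_bot hbot hne p), EReal.coe_le_coe_iff]
  refine hM.2 ?_
  rintro _ ⟨x, hx, rfl⟩
  rw [← EReal.coe_le_coe_iff, EReal.coe_toReal htop (conj_ne_bot hbot hne p)]
  exact coe_le_conj hbot hx p

theorem dom_conj (hbot : ∀ x, f x ≠ ⊥) (hne : (dom f).Nonempty) :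
    dom (conj f) = conjDom (dom f) fun x => (f x).toReal := by
  ext p
  constructor
  · intro hp
    refine ⟨(conj f p).toReal, ?_⟩
    rintro _ ⟨x, hx, rfl⟩
    rw [← EReal.coe_le_coe_iff, EReal.coe_toReal (ne_of_lt hp) (conj_ne_bot hbot hne p)]
    exact coe_le_conj hbot hx p
  · rintro ⟨M, hM⟩
    exact (conj_le_coe hbot hM).trans_lt (EReal.coe_lt_top M)

theorem ind_ne_bot (C : Set (EuclideanSpace ℝ (Fin n))) (x : EuclideanSpace ℝ (Fin n)) :
    ind C x ≠ ⊥ := by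
  unfold ind; split_ifs <;> simp

theorem toReal_ind (C : Set (EuclideanSpace ℝ (Fin n))) (x : EuclideanSpace ℝ (Fin n)) :
    (ind C x).toReal = 0 := by
  unfold ind; split_ifs <;> simp

theorem dom_ind (C : Set (EuclideanSpace ℝ (Fin n))) : dom (ind C) = C := by
  ext x
  by_cases hx : x ∈ C <;> simp [dom, ind, hx]

theorem bddAbove_inner_of_mem_dom_conj_ind {C : Set (EuclideanSpace ℝ (Fin n))}
    (hC : C.Nonempty) {x : EuclideanSpace ℝ (Fin n)} (hx : x ∈ dom (conj (ind C))) :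
    BddAbove ((fun p => inner ℝ x p) '' C) := by
  rw [dom_conj (ind_ne_bot C) (by rwa [dom_ind]), dom_ind] at hx
  simpa [conjDom, toReal_ind] using hx

theorem mem_subdiff_iff (hbot : ∀ x, f x ≠ ⊥) {x : EuclideanSpace ℝ (Fin n)} (hx : x ∈ dom f)
    (p : EuclideanSpace ℝ (Fin n)) :
    p ∈ subdiff f x ↔ ∀ y ∈ dom f, (f x).toReal + inner ℝ p (y - x) ≤ (f y).toReal := by
  simp only [subdiff, mem_ofPred_eq]
  refine ⟨fun h y hy => ?_, fun h y => ?_⟩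
  · have := h y
    rwa [← coe_toReal_of_mem_dom hbot hx, ← coe_toReal_of_mem_dom hbot hy, ← EReal.coe_add,
      EReal.coe_le_coe_iff] at this
  · by_cases hy : y ∈ dom f
    · rw [← coe_toReal_of_mem_dom hbot hx, ← coe_toReal_of_mem_dom hbot hy, ← EReal.coe_add,
        EReal.coe_le_coe_iff]
      exact h y hy
    · rw [show f y = ⊤ from not_lt_top_iff.1 hy]
      exact le_top

theorem IsGammaZero.nonempty_dom (hf : IsGammaZero f) : (dom f).Nonempty :=
  hf.proper.imp fun _ => lt_top_iff_ne_top.2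

theorem IsGammaZero.epigraph_eq (hf : IsGammaZero f) :
    {w : EuclideanSpace ℝ (Fin n) × ℝ | w.1 ∈ dom f ∧ (f w.1).toReal ≤ w.2}
      = {w | f w.1 ≤ (w.2 : EReal)} := by
  ext ⟨x, r⟩
  constructor
  · rintro ⟨h1, h2⟩
    change f x ≤ r
    rw [← coe_toReal_of_mem_dom hf.ne_bot h1]
    exact EReal.coe_le_coe_iff.2 h2
  · intro h
    have hx : x ∈ dom f := lt_of_le_of_lt h (EReal.coe_lt_top r)
    refine ⟨hx, ?_⟩
    rw [← EReal.coe_le_coe_iff, coe_toReal_of_mem_dom hf.ne_bot hx]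
    exact h

theorem IsLegendre.isLegendreOn (hH : IsGammaZero H) (hL : IsLegendre H) :
    IsLegendreOn (dom H) fun p => (H p).toReal where
  nonempty := hH.nonempty_dom
  convexOn := convexOn_iff_convex_epigraph.2 (by rw [hH.epigraph_eq]; exact hH.convex)
  isClosed_epigraph := by
    rw [hH.epigraph_eq]
    exact (lowerSemicontinuous_iff_isClosed_epigraph.1 hH.lsc).preimage
      (continuous_fst.prodMk (continuous_coe_real_ereal.comp continuous_snd))
  mem_interior p hp u hu := by
    by_contra hni
    have := (mem_subdiff_iff hH.ne_bot hp u).2 hu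
    rw [hL.subdiff_boundary p ⟨hp, hni⟩] at this
    exact this
  strictConvexOn := hL.strictConvex

/-- A closed proper function that grows faster than every linear function has a conjugate that is
finite everywhere. -/
theorem IsOneCoercive.conjDom_eq_univ (hJ : IsGammaZero J) (hJc : IsOneCoercive J) :
    conjDom (dom J) (fun x => (J x).toReal) = univ := by
  refine eq_univ_of_forall fun p => ?_
  obtain ⟨R, -, hR⟩ := (Metric.hasBasis_cobounded_compl_closedBall
    (0 : EuclideanSpace ℝ (Fin n))).eventually_iff.1
      (hJc.eventually (Ioi_mem_nhds (EReal.coe_lt_top ‖p‖)))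
  obtain ⟨m, hm⟩ : ∃ m : ℝ, ∀ x ∈ Metric.closedBall (0 : EuclideanSpace ℝ (Fin n)) (max R 0),
      (m : EReal) ≤ J x := by
    obtain ⟨x₀, -, hx₀⟩ := (hJ.lsc.lowerSemicontinuousOn _).exists_isMinOn
      ⟨0, Metric.mem_closedBall_self (le_max_right R 0)⟩ (isCompact_closedBall 0 (max R 0))
    have hlt : (⊥ : EReal) < J x₀ := bot_lt_iff_ne_bot.2 (hJ.ne_bot x₀)
    obtain ⟨m, -, hm⟩ := EReal.lt_iff_exists_real_btwn.1 hlt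
    exact ⟨m, fun x hx => hm.le.trans (isMinOn_iff.1 hx₀ x hx)⟩
  refine ⟨max (‖p‖ * max R 0 - m) 0, ?_⟩
  rintro _ ⟨x, hx, rfl⟩
  have hxr := coe_toReal_of_mem_dom hJ.ne_bot hx
  have hpx := real_inner_le_norm p x
  by_cases hxR : x ∈ Metric.closedBall (0 : EuclideanSpace ℝ (Fin n)) (max R 0)
  · refine le_max_of_le_left ?_
    have h1 := hm x hxR
    rw [← hxr, EReal.coe_le_coe_iff] at h1
    have h2 := mul_le_mul_of_nonneg_left (mem_closedBall_zero_iff.1 hxR) (norm_nonneg p)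
    simp only
    linarith
  · refine le_max_of_le_right ?_
    rw [mem_closedBall_zero_iff, not_le, max_lt_iff] at hxR
    have h1 : ((‖p‖ : ℝ) : EReal) < J x / ((‖x‖ : ℝ) : EReal) :=
      hR (by simpa using hxR.1)
    rw [← hxr, ← EReal.coe_div, EReal.coe_lt_coe_iff, lt_div_iff₀ hxR.2] at h1
    simp only
    linarith

/-- The real-valued function `J^*`. -/
noncomputable def realConj (J : EuclideanSpace ℝ (Fin n) → EReal)
    (p : EuclideanSpace ℝ (Fin n)) : ℝ := (conj J p).toReal

theorem coe_realConj (hJ : IsGammaZero J) (hJc : IsOneCoercive J)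
    (p : EuclideanSpace ℝ (Fin n)) : (realConj J p : EReal) = conj J p := by
  have hp : p ∈ dom (conj J) := by
    rw [dom_conj hJ.ne_bot hJ.nonempty_dom, hJc.conjDom_eq_univ hJ]; trivial
  exact EReal.coe_toReal (ne_of_lt hp) (conj_ne_bot hJ.ne_bot hJ.nonempty_dom p)

theorem convexOn_realConj (hJ : IsGammaZero J) (hJc : IsOneCoercive J) :
    ConvexOn ℝ univ (realConj J) := by
  have h1 := convexOn_sSup_conj (h := fun x => (J x).toReal) hJ.nonempty_dom
  rw [hJc.conjDom_eq_univ hJ] at h1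
  refine h1.congr fun p _ => ?_
  have hp : p ∈ conjDom (dom J) fun x => (J x).toReal := by rw [hJc.conjDom_eq_univ hJ]; trivial
  have h2 := conj_eq_coe hJ.ne_bot (isLUB_csSup (hJ.nonempty_dom.image _) hp)
  simp only [realConj, h2, EReal.toReal_coe]

theorem le_realConj (hJ : IsGammaZero J) (hJc : IsOneCoercive J) (h0 : 0 ∈ dom J)
    (p : EuclideanSpace ℝ (Fin n)) : -(J 0).toReal ≤ realConj J p := by
  have := coe_le_conj hJ.ne_bot h0 p
  rw [← coe_realConj hJ hJc, EReal.coe_le_coe_iff] at this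
  simpa using this

/-! ### The conjugate of a Legendre function -/

theorem convexOn_zero : ConvexOn ℝ univ (0 : EuclideanSpace ℝ (Fin n) → ℝ) :=
  convexOn_const 0 convex_univ

/-- The maximum `(t H)^*(x)` of `⟨x, ·⟩ - t H` equals `t H^*(x / t)`, and both are attained at the
same point. -/
theorem argmax_zero_eq (hH : IsGammaZero H) (hL : IsLegendre H) {x : EuclideanSpace ℝ (Fin n)}
    {t : ℝ} (hz : (x, t) ∈ perspectiveCone (dom H) fun p => (H p).toReal) :
    argmax (dom H) (fun p => (H p).toReal) 0 (x, t)
      = argmax (dom H) (fun p => (H p).toReal) 0 (t⁻¹ • x, 1) := by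
  have hLo := hL.isLegendreOn hH
  have hz1 : (t⁻¹ • x, (1 : ℝ)) ∈ perspectiveCone (dom H) fun p => (H p).toReal :=
    ⟨one_pos, by simpa using hz.2⟩
  obtain ⟨h1, h2⟩ := hLo.argmax_spec convexOn_zero (c := 0) (fun _ => le_rfl) hz1
  refine hLo.argmax_eq convexOn_zero hz.1 h1 (isMaxOn_iff.2 fun q hq => ?_)
  have h3 := mul_le_mul_of_nonneg_left (isMaxOn_iff.1 h2 q hq) hz.1.le
  have ht : (t : ℝ) ≠ 0 := hz.1.ne'
  simp only [score, real_inner_smul_left, Pi.zero_apply, mul_sub, mul_inv_cancel_left₀ ht,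
    one_mul, mul_zero] at h3 ⊢
  exact h3

theorem mem_perspectiveCone_one (hH : IsGammaZero H) {y : EuclideanSpace ℝ (Fin n)}
    (hy : y ∈ interior (dom (conj H))) :
    (y, (1 : ℝ)) ∈ perspectiveCone (dom H) fun p => (H p).toReal := by
  rw [dom_conj hH.ne_bot hH.nonempty_dom] at hy
  exact ⟨one_pos, by simpa using hy⟩

theorem conj_eq_maxValue (hH : IsGammaZero H) (hL : IsLegendre H)
    {y : EuclideanSpace ℝ (Fin n)} (hy : y ∈ interior (dom (conj H))) :
    conj H y = (maxValue (dom H) (fun p => (H p).toReal) 0 (y, 1) : ℝ) := by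
  obtain ⟨h1, h2⟩ := (hL.isLegendreOn hH).argmax_spec convexOn_zero (c := 0) (fun _ => le_rfl)
    (mem_perspectiveCone_one hH hy)
  refine conj_eq_coe hH.ne_bot (IsGreatest.isLUB ⟨⟨_, h1, ?_⟩, ?_⟩)
  · simp [maxValue, score]
  · rintro _ ⟨q, hq, rfl⟩
    simpa [maxValue, score] using isMaxOn_iff.1 h2 q hq

/-- The gradient of the section `V(·, t)` of a function with differential `w ↦ ⟨p, w.1⟩ - a w.2`. -/
theorem hasGradientAt_section {V : EuclideanSpace ℝ (Fin n) × ℝ → ℝ}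
    {x p : EuclideanSpace ℝ (Fin n)} {t : ℝ} {L : EuclideanSpace ℝ (Fin n) × ℝ →L[ℝ] ℝ}
    (hV : HasFDerivAt V L (x, t)) (hL : ∀ w, L (w, 0) = inner ℝ p w) :
    HasGradientAt (fun y => V (y, t)) p x := by
  rw [hasGradientAt_iff_hasFDerivAt]
  refine (hV.comp x ((hasFDerivAt_id x).prodMk (hasFDerivAt_const t x))).congr_fderiv ?_
  ext w
  simp [hL]

theorem egrad_conj (hH : IsGammaZero H) (hL : IsLegendre H)
    {y : EuclideanSpace ℝ (Fin n)} (hy : y ∈ interior (dom (conj H))) :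
    egrad (conj H) y = argmax (dom H) (fun p => (H p).toReal) 0 (y, 1) := by
  have hd := (hL.isLegendreOn hH).hasFDerivAt_maxValue convexOn_zero (c := 0) (fun _ => le_rfl)
    (mem_perspectiveCone_one hH hy)
  refine HasGradientAt.gradient ((hasGradientAt_section hd fun w => ?_).congr_of_eventuallyEq ?_)
  · simp [scoreDeriv_apply, real_inner_comm]
  · filter_upwards [isOpen_interior.mem_nhds hy] with w hw
    rw [conj_eq_maxValue hH hL hw, EReal.toReal_coe]

theorem egrad_conj_mem (hH : IsGammaZero H) (hL : IsLegendre H)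
    {y : EuclideanSpace ℝ (Fin n)} (hy : y ∈ interior (dom (conj H))) :
    egrad (conj H) y ∈ interior (dom H) := by
  rw [egrad_conj hH hL hy]
  exact (hL.isLegendreOn hH).argmax_mem_interior convexOn_zero (c := 0) (fun _ => le_rfl)
    (mem_perspectiveCone_one hH hy)

/-- The equality case of the Fenchel–Young inequality. -/
theorem conj_eq_of_interior (hH : IsGammaZero H) (hL : IsLegendre H)
    {y : EuclideanSpace ℝ (Fin n)} (hy : y ∈ interior (dom (conj H))) :
    conj H y = (inner ℝ y (egrad (conj H) y) - (H (egrad (conj H) y)).toReal : ℝ) := by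
  rw [conj_eq_maxValue hH hL hy, egrad_conj hH hL hy]
  simp [maxValue, score]

theorem egrad_egrad_conj (hH : IsGammaZero H) (hL : IsLegendre H)
    {v : EuclideanSpace ℝ (Fin n)} (hv : v ∈ interior (dom (conj H))) :
    egrad H (egrad (conj H) v) = v := by
  have hp := egrad_conj_mem hH hL hv
  have hsub : v ∈ subdiff H (egrad (conj H) v) := by
    rw [mem_subdiff_iff hH.ne_bot (interior_subset hp)]
    intro q hq
    have h1 := coe_le_conj hH.ne_bot hq v
    rw [conj_eq_of_interior hH hL hv, EReal.coe_le_coe_iff] at h1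
    rw [inner_sub_right]
    linarith
  rw [hL.subdiff_interior _ hp] at hsub
  exact (mem_singleton_iff.1 hsub).symm

theorem egrad_mem_and_egrad_conj_egrad (hH : IsGammaZero H) (hL : IsLegendre H)
    {p : EuclideanSpace ℝ (Fin n)} (hp : p ∈ interior (dom H)) :
    egrad H p ∈ interior (dom (conj H)) ∧ egrad (conj H) (egrad H p) = p := by
  have hLo := hL.isLegendreOn hH
  have hpD := interior_subset hp
  have hsub : egrad H p ∈ subdiff H p := by rw [hL.subdiff_interior p hp]; rfl
  rw [mem_subdiff_iff hH.ne_bot hpD] at hsub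
  have hv : egrad H p ∈ interior (dom (conj H)) := by
    rw [dom_conj hH.ne_bot hH.nonempty_dom]
    exact hLo.mem_interior_conjDom hpD hsub
  refine ⟨hv, ?_⟩
  rw [egrad_conj hH hL hv]
  refine hLo.argmax_eq convexOn_zero one_pos hpD (isMaxOn_iff.2 fun q hq => ?_)
  have := hsub q hq
  simp only [score, Pi.zero_apply, inner_sub_right] at *
  linarith

/-! ### The optimal-value function -/

theorem interior_domF (hH : IsGammaZero H) :
    interior (domF H) = perspectiveCone (dom H) fun p => (H p).toReal := by
  have hsub : perspectiveCone (dom H) (fun p => (H p).toReal) ⊆ domF H := fun q hq =>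
    Or.inl ⟨hq.1, by rw [dom_conj hH.ne_bot hH.nonempty_dom]; exact hq.2⟩
  refine Subset.antisymm (fun q hq => ?_) (interior_maximal hsub (isOpen_perspectiveCone _ _))
  rcases interior_subset hq with ⟨h1, h2⟩ | ⟨-, h2⟩
  · exact ⟨h1, by rw [dom_conj hH.ne_bot hH.nonempty_dom] at h2; exact h2⟩
  · -- arbitrarily close to a point with `t = 0` there are points with `t < 0`
    exfalso
    have hc : Continuous fun s : ℝ => (q.1, s) := by fun_prop
    have hev : ∀ᶠ s in 𝓝 (0 : ℝ), (q.1, s) ∈ domF H := by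
      refine (hc.tendsto 0).eventually (p := fun w => w ∈ domF H) ?_
      rw [← h2]
      exact mem_interior_iff_mem_nhds.1 hq
    obtain ⟨s, hs, hs0⟩ := ((hev.filter_mono nhdsWithin_le_nhds).and
      (self_mem_nhdsWithin : Iio (0 : ℝ) ∈ 𝓝[<] 0)).exists
    have hs0' : s < 0 := hs0
    rcases hs with ⟨h3, -⟩ | ⟨-, h3⟩
    · exact lt_asymm hs0' h3
    · exact hs0'.ne h3

/-- In the variable `p = ∇H^*(v)`, the objective is the difference of `(t H)^*(x)` and the
score of `p`. -/
theorem objective_eq (hJ : IsGammaZero J) (hH : IsGammaZero H) (hJc : IsOneCoercive J)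
    (hL : IsLegendre H) {x v : EuclideanSpace ℝ (Fin n)} {t : ℝ}
    (hz : (x, t) ∈ interior (domF H)) (hv : v ∈ interior (dom (conj H))) :
    objective J H x t v = (maxValue (dom H) (fun p => (H p).toReal) 0 (x, t)
      - score (fun p => (H p).toReal) (realConj J) (x, t) (egrad (conj H) v) : ℝ) := by
  rw [interior_domF hH] at hz
  have hy : t⁻¹ • x ∈ interior (dom (conj H)) := by
    rw [dom_conj hH.ne_bot hH.nonempty_dom]; exact hz.2
  have ht : t ≠ 0 := hz.1.ne'
  rw [objective, bregman, conj_eq_maxValue hH hL hy, conj_eq_of_interior hH hL hv,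
    ← coe_realConj hJ hJc, maxValue, maxValue, argmax_zero_eq hH hL hz]
  norm_cast
  simp only [score, real_inner_smul_left, inner_sub_right, real_inner_smul_right, Pi.zero_apply,
    real_inner_comm]
  field_simp
  ring

theorem optValue_eq (hJ : IsGammaZero J) (hH : IsGammaZero H) (hJc : IsOneCoercive J)
    (hL : IsLegendre H) (h0 : 0 ∈ dom J) {x : EuclideanSpace ℝ (Fin n)} {t : ℝ}
    (hz : (x, t) ∈ interior (domF H)) :
    optValue J H x t = (maxValue (dom H) (fun p => (H p).toReal) 0 (x, t)
      - maxValue (dom H) (fun p => (H p).toReal) (realConj J) (x, t) : ℝ) := by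
  have hz' := hz
  rw [interior_domF hH] at hz'
  have hLo := hL.isLegendreOn hH
  obtain ⟨-, h2⟩ := hLo.argmax_spec (convexOn_realConj hJ hJc) (le_realConj hJ hJc h0) hz'
  have h3 := hLo.argmax_mem_interior (convexOn_realConj hJ hJc) (le_realConj hJ hJc h0) hz'
  rw [optValue, if_pos hz'.1]
  refine le_antisymm ?_ (le_iInf₂ fun v hv => ?_)
  · obtain ⟨h4, h5⟩ := egrad_mem_and_egrad_conj_egrad hH hL h3
    refine (iInf₂_le _ h4).trans_eq ?_
    rw [objective_eq hJ hH hJc hL hz h4, h5]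
    rfl
  · rw [objective_eq hJ hH hJc hL hz hv, EReal.coe_le_coe_iff]
    exact sub_le_sub_left
      (isMaxOn_iff.1 h2 _ (interior_subset (egrad_conj_mem hH hL hv))) _

theorem exists_isLUB_initial (hJ : IsGammaZero J) (hH : IsGammaZero H) (hJc : IsOneCoercive J)
    (h0 : 0 ∈ dom J) {x : EuclideanSpace ℝ (Fin n)} (hx : x ∈ dom (conj (ind (dom H)))) :
    ∃ a b : ℝ, IsLUB ((fun p => inner ℝ x p - (0 : EuclideanSpace ℝ (Fin n) → ℝ) p) '' dom H) a ∧
      IsLUB ((fun p => inner ℝ x p - realConj J p) '' dom H) b ∧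
      optValue J H x 0 = (a - b : ℝ) := by
  have hb := bddAbove_inner_of_mem_dom_conj_ind hH.nonempty_dom hx
  have hb' : BddAbove ((fun p => inner ℝ x p - realConj J p) '' dom H) := by
    obtain ⟨M, hM⟩ := hb
    refine ⟨M + (J 0).toReal, ?_⟩
    rintro _ ⟨p, hp, rfl⟩
    have h1 := hM ⟨p, hp, rfl⟩
    have h2 := le_realConj hJ hJc h0 p
    simp only at h1 ⊢
    linarith
  have hA := isLUB_csSup (hH.nonempty_dom.image _) hb
  have hB := isLUB_csSup (hH.nonempty_dom.image _) hb'
  refine ⟨_, _, by simpa using hA, hB, ?_⟩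
  have hdom : dom (fun p => conj J p + ind (dom H) p) = dom H := by
    ext p
    by_cases hp : p ∈ dom H
    · simp [dom, ind, ← coe_realConj hJ hJc, show H p < ⊤ from hp]
    · simp [dom, ind, ← coe_realConj hJ hJc, show ¬ H p < ⊤ from hp]
  have h1 : conj (ind (dom H)) x = (sSup ((fun p => inner ℝ x p) '' dom H) : ℝ) :=
    conj_eq_coe (ind_ne_bot _) (by simpa [dom_ind, toReal_ind] using hA)
  have h2 : conj (fun p => conj J p + ind (dom H) p) x
      = (sSup ((fun p => inner ℝ x p - realConj J p) '' dom H) : ℝ) := by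
    refine conj_eq_coe (fun p => ?_) ?_
    · rw [← coe_realConj hJ hJc]
      by_cases hp : p ∈ dom H <;> simp [ind, hp]
    · rw [hdom]
      have : (fun p => inner ℝ x p - (conj J p + ind (dom H) p).toReal) '' dom H
          = (fun p => inner ℝ x p - realConj J p) '' dom H :=
        image_congr fun p hp => by simp [ind, hp, realConj]
      rwa [this]
  rw [optValue, if_neg (lt_irrefl 0), h1, h2, EReal.coe_sub]

/-- Both terms of `F = (t H)^*(x) - (J^* + t H)^*(x)` are differentiable. -/
theorem hasFDerivAt_optValue (hJ : IsGammaZero J) (hH : IsGammaZero H) (hJc : IsOneCoercive J)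
    (hL : IsLegendre H) (h0 : 0 ∈ dom J) {z : EuclideanSpace ℝ (Fin n) × ℝ}
    (hz : z ∈ interior (domF H)) :
    HasFDerivAt (fun q : EuclideanSpace ℝ (Fin n) × ℝ => (optValue J H q.1 q.2).toReal)
      (scoreDeriv (fun p => (H p).toReal) (argmax (dom H) (fun p => (H p).toReal) 0 z)
        - scoreDeriv (fun p => (H p).toReal)
          (argmax (dom H) (fun p => (H p).toReal) (realConj J) z)) z := by
  have hz' := hz
  rw [interior_domF hH] at hz'
  have hLo := hL.isLegendreOn hH
  refine ((hLo.hasFDerivAt_maxValue convexOn_zero (c := 0) (fun _ => le_rfl) hz').sub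
    (hLo.hasFDerivAt_maxValue (convexOn_realConj hJ hJc)
      (le_realConj hJ hJc h0) hz')).congr_of_eventuallyEq ?_
  filter_upwards [isOpen_interior.mem_nhds hz] with w hw
  rw [optValue_eq hJ hH hJc hL h0 hw, EReal.toReal_coe]
  rfl

/-- The maximizer for `(J^* + t H)^*` is the shifted point `∇H^*(x / t) - ∇ₓF`. -/
theorem egrad_conj_sub_egrad_optValue (hJ : IsGammaZero J) (hH : IsGammaZero H)
    (hJc : IsOneCoercive J) (hL : IsLegendre H) (h0 : 0 ∈ dom J)
    {x : EuclideanSpace ℝ (Fin n)} {t : ℝ} (hz : (x, t) ∈ interior (domF H)) :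
    egrad (conj H) (t⁻¹ • x) - egrad (fun y => optValue J H y t) x
      = argmax (dom H) (fun p => (H p).toReal) (realConj J) (x, t) := by
  have hz' := hz
  rw [interior_domF hH] at hz'
  have hy : t⁻¹ • x ∈ interior (dom (conj H)) := by
    rw [dom_conj hH.ne_bot hH.nonempty_dom]; exact hz'.2
  rw [egrad_conj hH hL hy, ← argmax_zero_eq hH hL hz']
  have : egrad (fun y => optValue J H y t) x
      = argmax (dom H) (fun p => (H p).toReal) 0 (x, t)
        - argmax (dom H) (fun p => (H p).toReal) (realConj J) (x, t) := by
    refine (hasGradientAt_section (hasFDerivAt_optValue hJ hH hJc hL h0 hz) fun w => ?_).gradient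
    simp [scoreDeriv_apply, inner_sub_left, real_inner_comm]
  rw [this, sub_sub_cancel]

end Extended
end NonAdditive

open NonAdditive in
theorem proposition3p3 {n : ℕ} (J H : EuclideanSpace ℝ (Fin n) → EReal)
    (hJ : IsGammaZero J) (hH : IsGammaZero H)
    (hJc : IsOneCoercive J) (hHL : IsLegendre H) (h0 : 0 ∈ dom J) :
    -- `F` is real-valued on its domain
    (∀ q ∈ domF H, optValue J H q.1 q.2 ≠ ⊥ ∧ optValue J H q.1 q.2 ≠ ⊤) ∧
    -- `F` is continuously differentiable in the interior of its domain
    ContDiffOn ℝ 1 (fun q : EuclideanSpace ℝ (Fin n) × ℝ => (optValue J H q.1 q.2).toReal)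
      (interior (domF H)) ∧
    -- the differential equation, all of whose terms are well defined
    (∀ (x : EuclideanSpace ℝ (Fin n)) (t : ℝ), (x, t) ∈ interior (domF H) →
      egrad (conj H) (t⁻¹ • x) ∈ interior (dom H) ∧
      egrad (conj H) (t⁻¹ • x) - egrad (fun y => optValue J H y t) x ∈ interior (dom H) ∧
      ((deriv (fun s => (optValue J H x s).toReal) t : ℝ) : EReal)
        + H (egrad (conj H) (t⁻¹ • x))
        - H (egrad (conj H) (t⁻¹ • x) - egrad (fun y => optValue J H y t) x) = 0) ∧
    -- the initial value is attained along rays, which stay in the domain of `F`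
    (∀ d ∈ interior (dom (conj H)), ∀ x ∈ dom (conj (ind (dom H))),
      (∀ t : ℝ, 0 < t → (x + t • d, t) ∈ domF H) ∧
      Filter.Tendsto (fun t : ℝ => optValue J H (x + t • d) t) (𝓝[>] 0)
        (𝓝 (optValue J H x 0))) ∧
    -- the minimizer exists, is unique, and is given by the gradient formula
    (∀ t : ℝ, 0 < t → ∀ x ∈ t • interior (dom (conj H)),
      egrad (conj H) (t⁻¹ • x) - egrad (fun y => optValue J H y t) x ∈ interior (dom H) ∧
      ∀ v : EuclideanSpace ℝ (Fin n),
        (v ∈ interior (dom (conj H)) ∧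
          IsMinOn (objective J H x t) (interior (dom (conj H))) v) ↔
        v = egrad H (egrad (conj H) (t⁻¹ • x) - egrad (fun y => optValue J H y t) x)) := by
  have hL := hHL.isLegendreOn hH
  have hg := convexOn_realConj hJ hJc
  have hgc := le_realConj hJ hJc h0
  have hcd := dom_conj hH.ne_bot hH.nonempty_dom
  have hint := interior_domF hH
  have hmem : ∀ x t, (x, t) ∈ interior (domF H) →
      egrad (conj H) (t⁻¹ • x) - egrad (fun y => optValue J H y t) x ∈ interior (dom H) := by
    intro x t hz
    rw [egrad_conj_sub_egrad_optValue hJ hH hJc hHL h0 hz]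
    exact hL.argmax_mem_interior hg hgc (hint ▸ hz)
  refine ⟨?_, ?_, ?_, ?_, ?_⟩
  · rintro ⟨x, t⟩ hq
    rcases hq with hq | ⟨hx, rfl : t = 0⟩
    · have hz : (x, t) ∈ interior (domF H) := by rw [hint]; exact ⟨hq.1, hcd ▸ hq.2⟩
      rw [optValue_eq hJ hH hJc hHL h0 hz]
      exact ⟨EReal.coe_ne_bot _, EReal.coe_ne_top _⟩
    · obtain ⟨a, b, -, -, hab⟩ := exists_isLUB_initial hJ hH hJc h0 hx
      rw [hab]
      exact ⟨EReal.coe_ne_bot _, EReal.coe_ne_top _⟩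
  · have hc := (hL.contDiffOn_maxValue convexOn_zero (c := 0) (fun _ => le_rfl)).sub
      (hL.contDiffOn_maxValue hg hgc)
    rw [← hint] at hc
    refine hc.congr fun q hq => ?_
    rw [optValue_eq hJ hH hJc hHL h0 hq, EReal.toReal_coe]
  · intro x t hz
    have hz' := hz
    rw [hint] at hz'
    have hy : t⁻¹ • x ∈ interior (dom (conj H)) := hcd ▸ hz'.2
    have h1 := egrad_conj_mem hH hHL hy
    have h2 := hmem x t hz
    refine ⟨h1, h2, ?_⟩
    have hd := ((hasFDerivAt_optValue hJ hH hJc hHL h0 hz).comp_hasDerivAt t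
      ((hasDerivAt_const t x).prodMk (hasDerivAt_id t))).deriv
    simp only [Function.comp_def] at hd
    rw [hd, ← coe_toReal_of_mem_dom hH.ne_bot (interior_subset h1),
      ← coe_toReal_of_mem_dom hH.ne_bot (interior_subset h2),
      egrad_conj_sub_egrad_optValue hJ hH hJc hHL h0 hz, egrad_conj hH hHL hy,
      ← argmax_zero_eq hH hHL hz', sub_apply, scoreDeriv_apply,
      scoreDeriv_apply]
    norm_cast
    simp
  · intro d hd x hx
    have hd' : d ∈ interior (conjDom (dom H) fun p => (H p).toReal) := hcd ▸ hd
    have hb := bddAbove_inner_of_mem_dom_conj_ind hH.nonempty_dom hx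
    have hray : ∀ t : ℝ, 0 < t → (x + t • d, t) ∈ interior (domF H) := fun t ht => by
      rw [hint]; exact ray_mem_perspectiveCone hd' hb ht
    refine ⟨fun t ht => interior_subset (hray t ht), ?_⟩
    obtain ⟨a, b, ha, hb', hab⟩ := exists_isLUB_initial hJ hH hJc h0 hx
    rw [hab]
    have hlim := (hL.tendsto_maxValue_ray convexOn_zero (c := 0) (fun _ => le_rfl) hd' hb ha).sub
      (hL.tendsto_maxValue_ray hg hgc hd' hb hb')
    refine ((continuous_coe_real_ereal.tendsto _).comp hlim).congr' ?_
    filter_upwards [self_mem_nhdsWithin] with t ht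
    exact (optValue_eq hJ hH hJc hHL h0 (hray t ht)).symm
  · rintro t ht _ ⟨y, hy, rfl⟩
    have hz : (t • y, t) ∈ interior (domF H) := by
      rw [hint]
      refine ⟨ht, ?_⟩
      rw [inv_smul_smul₀ ht.ne', ← hcd]
      exact hy
    refine ⟨hmem _ _ hz, fun v => ?_⟩
    have hp := hmem _ _ hz
    rw [egrad_conj_sub_egrad_optValue hJ hH hJc hHL h0 hz] at hp ⊢
    obtain ⟨hpD, hmax⟩ := hL.argmax_spec hg hgc (hint ▸ hz)
    obtain ⟨h1, h2⟩ := egrad_mem_and_egrad_conj_egrad hH hHL hp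
    constructor
    · rintro ⟨hv, hmin⟩
      have h3 := isMinOn_iff.1 hmin _ h1
      rw [objective_eq hJ hH hJc hHL hz hv, objective_eq hJ hH hJc hHL hz h1, h2,
        EReal.coe_le_coe_iff, sub_le_sub_iff_left] at h3
      rw [hL.argmax_eq hg ht (interior_subset (egrad_conj_mem hH hHL hv))
        (isMaxOn_iff.2 fun q hq => (isMaxOn_iff.1 hmax q hq).trans h3), egrad_egrad_conj hH hHL hv]
    · rintro rfl
      refine ⟨h1, isMinOn_iff.2 fun w hw => ?_⟩
      rw [objective_eq hJ hH hJc hHL hz hw, objective_eq hJ hH hJc hHL hz h1, h2,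
        EReal.coe_le_coe_iff, sub_le_sub_iff_left]
      exact isMaxOn_iff.1 hmax _ (interior_subset (egrad_conj_mem hH hHL hw))
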